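/- All graphs are finite and simple. For a graph $G$ and positive integers $k, m$: $G^{1/m}$ is the graph obtained from $G$ by replacing each edge with a path with $m$ edges; $G^{k}$ is the graph on $V(G)$ in which two distinct vertices are adjacent iff there is a walk of length $k$ between them in $G$; and $G^{k/m}=(G^{1/m})^{k}$. Let $\mathrm{og}(G)$ be the odd girth of $G$ (the length of a shortest odd cycle). For positive integers $n\ge 2d$ the circular complete graph $K_{n/d}$ has vertex set $\{0,\dots,n-1\}$, with $i,j$ adjacent iff $d\le |i-j|\le n-d$, and $\chi_c(G)$ is the infimum of $n/d$ over all pairs $(n,d)$ such that $G$ admits a homomorphism to $K_{n/d}$. For a non-bipartite graph $G$ with chromatic number $\chi(G)$ and an integer $i\ge 3-\chi(G)$ put $$\theta_i(G)=\sup\left\{\tfrac{2r+1}{2s+1} : r,s\in\mathbb{Z}_{\ge 0},\ \chi\bigl(G^{\frac{2r+1}{2s+1}}\bigr)\le \chi(G)+i,\ \tfrac{2r+1}{2s+1}<\mathrm{og}(G)\right\},$$ and $\mu(G)=\theta_{3-\chi(G)}(G)$. **Corollary.** Let $r$ and $s$ be non-negative integers and let $G$ be a non-bipartite graph with $\frac{2r+1}{2s+1}<\mathrm{og}(G)$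 (equivalently, no closed walk of length $2r+1$ exists in $G^{\frac{1}{2s+1}}$, so that no loops have to be suppressed in $G^{\frac{2r+1}{2s+1}}$). If $\chi_c\bigl(G^{\frac{2r+1}{2s+1}}\bigr)<4$, then $$\mu\bigl(G^{\frac{2r+1}{2s+1}}\bigr)=\frac{2s+1}{2r+1}\,\mu(G)=\frac{2s+1}{3(2r+1)}\cdot\frac{\chi_c(G)}{\chi_c(G)-2}.$$ -/

import Mathlib

namespace GraphPower

universe u

variable {V : Type u}

/-- The `k`-th power `G^k`: distinct vertices `u`, `v` are adjacent iff `G` has a walk of length `k`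
between them. -/
def power (G : SimpleGraph V) (k : ℕ) : SimpleGraph V where
  Adj a b := a ≠ b ∧ ∃ p : G.Walk a b, p.length = k
  symm := ⟨fun a b ⟨hab, p, hp⟩ => ⟨hab.symm, p.reverse, by rw [p.length_reverse, hp]⟩⟩
  loopless := ⟨fun _ h => h.1 rfl⟩

/-- Vertices of the `s`-subdivision: the vertices of `G`, and `s - 1` inner vertices per edge. -/
abbrev SubdivVertex (G : SimpleGraph V) (s : ℕ) : Type u :=
  V ⊕ (G.edgeSet × Fin (s - 1))

/-- The `i`-th vertex (`0 ≤ i ≤ s`) on the path with `s` edges that replaces the edge `e`. The path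
runs from one end of `e` to the other, in a direction that is chosen once for each edge. -/
noncomputable def pathVertex (G : SimpleGraph V) (s : ℕ) (e : G.edgeSet) (i : ℕ) :
    SubdivVertex G s :=
  if i = 0 then Sum.inl (Quot.out e.1).1
  else if h : i - 1 < s - 1 then Sum.inr (e, ⟨i - 1, h⟩)
  else Sum.inl (Quot.out e.1).2

/-- The graph `G^{1/s}` (`s ≥ 1`): every edge of `G` is replaced by a path with `s` edges
(hence with `s + 1` vertices, the two ends of the edge included). -/
def subdivision (G : SimpleGraph V) (s : ℕ) : SimpleGraph (SubdivVertex G s) where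
  Adj x y := x ≠ y ∧ ∃ (e : G.edgeSet) (i : ℕ), i < s ∧
    ((x = pathVertex G s e i ∧ y = pathVertex G s e (i + 1)) ∨
      (y = pathVertex G s e i ∧ x = pathVertex G s e (i + 1)))
  symm := ⟨fun _ _ ⟨hxy, e, i, hi, h⟩ => ⟨hxy.symm, e, i, hi, h.symm⟩⟩
  loopless := ⟨fun _ h => h.1 rfl⟩

/-- The fractional power `G^{r/s} = (G^{1/s})^r`. -/
def fracPower (G : SimpleGraph V) (r s : ℕ) : SimpleGraph (SubdivVertex G s) :=
  power (subdivision G s) r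

/-- The odd girth of `G`: the length of a shortest odd cycle (`⊤` if there is none). -/
noncomputable def oddGirth (G : SimpleGraph V) : ℕ∞ :=
  ⨅ (a : V) (w : G.Walk a a) (_ : w.IsCycle) (_ : Odd w.length), (w.length : ℕ∞)

/-- The circular complete graph `K_{n/d}` on `{0, …, n - 1}`: `i` and `j` are adjacent iff
`d ≤ |i - j| ≤ n - d`. (For `d ≥ 1` the condition `i ≠ j` is automatic.) -/
def circularComplete (n d : ℕ) : SimpleGraph (Fin n) where
  Adj i j := i ≠ j ∧ (d : ℤ) ≤ |(i : ℤ) - (j : ℤ)| ∧ |(i : ℤ) - (j : ℤ)| ≤ (n : ℤ) - (d : ℤ)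
  symm := ⟨fun i j ⟨h, h1, h2⟩ => ⟨h.symm, by rwa [abs_sub_comm], by rwa [abs_sub_comm]⟩⟩
  loopless := ⟨fun _ h => h.1 rfl⟩

/-- The circular chromatic number `χ_c(G)`: the infimum of `n / d` over all `(n, d)`-colourings. -/
noncomputable def circularChromaticNumber (G : SimpleGraph V) : ℝ :=
  sInf {x : ℝ | ∃ n d : ℕ, 0 < d ∧ 2 * d ≤ n ∧ Nonempty (G →g circularComplete n d) ∧
    x = (n : ℝ) / (d : ℝ)}

/-- The chromatic number as a natural number (for graphs that have a finite colouring, in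
particular for all finite graphs). -/
noncomputable def chi (G : SimpleGraph V) : ℕ := G.chromaticNumber.toNat

/-- The `i`-th power thickness `θ_i(G)`, the supremum of the fractions `(2r+1)/(2s+1)` below the
odd girth of `G` for which `χ(G^{(2r+1)/(2s+1)}) ≤ χ(G) + i`. -/
noncomputable def powerThickness (G : SimpleGraph V) (i : ℤ) : ℝ :=
  sSup {x : ℝ | ∃ r s : ℕ,
    (chi (fracPower G (2 * r + 1) (2 * s + 1)) : ℤ) ≤ (chi G : ℤ) + i ∧
    ((2 * r + 1 : ℕ) : ℕ∞) < ((2 * s + 1 : ℕ) : ℕ∞) * oddGirth G ∧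
    x = (2 * r + 1 : ℝ) / (2 * s + 1 : ℝ)}

/-- `μ(G) = θ_{3 - χ(G)}(G)`. -/
noncomputable def mu (G : SimpleGraph V) : ℝ := powerThickness G (3 - (chi G : ℤ))

end GraphPower

namespace GraphPower

open SimpleGraph

universe v

/-! The infimum of the errors ε for which `HasCircularLabelling G ε` holds is c(G) = 1/2 - 1/χ_c(G)
(`isGLB_circularLabelling`): rounding labels to n-th parts of the circle turns labellings into
homomorphisms to K_{n/d}. Error 1/6 is exactly 3-colourability (`colorable_three_iff`). Errors scale
under both operations. Interpolating along paths divides them by m in G^{1/m}, and adding them along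
odd walks multiplies them by k in the k-th power. The hard step is undoing the power
(`HasCircularLabelling.of_power`): for errors below 1/4, the errors along walks of length k add up
without wrapping round the circle, and a shortest-path potential spreads them evenly over the edges.
Hence G^{k/m} is 3-colourable with k/m below the odd girth iff G has a labelling with error m/(6k),
so μ(G) = 1/(6c(G)). The hypothesis χ_c < 4 says c(G^{k/m}) < 1/4, whence c(G) = (m/k) c(G^{k/m}),
and both equalities follow. -/

/-- A labelling of the vertices by points of the circle `ℝ / ℤ` (represented by reals) such that
the labels of adjacent vertices are antipodal up to an error of at most `ε`. -/
def HasCircularLabelling {V : Type v} (G : SimpleGraph V) (ε : ℝ) : Prop :=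
  ∃ f : V → ℝ, ∀ u v, G.Adj u v → ∃ m : ℤ, |f v - f u - 1 / 2 - m| ≤ ε

/-! ### Circular labellings and odd powers -/

section Labelling

variable {V : Type v} {G : SimpleGraph V}

lemma HasCircularLabelling.mono {ε δ : ℝ} (h : HasCircularLabelling G ε) (hε : ε ≤ δ) :
    HasCircularLabelling G δ := by
  obtain ⟨f, hf⟩ := h
  exact ⟨f, fun u v huv => (hf u v huv).imp fun m hm => hm.trans hε⟩

lemma walk_label_error {ε : ℝ} {f : V → ℝ}
    (hf : ∀ u v, G.Adj u v → ∃ m : ℤ, |f v - f u - 1 / 2 - m| ≤ ε) {u v : V} (p : G.Walk u v) :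
    ∃ m : ℤ, |f v - f u - p.length / 2 - m| ≤ p.length * ε := by
  induction p with
  | nil => exact ⟨0, by simp⟩
  | @cons a b c h p ih =>
    obtain ⟨m, hm⟩ := ih
    obtain ⟨n, hn⟩ := hf a b h
    refine ⟨m + n, ?_⟩
    rw [abs_le] at *
    push_cast [Walk.length_cons]
    constructor <;> linarith [hm.1, hm.2, hn.1, hn.2]

lemma walk_label_error_of_odd {ε : ℝ} {f : V → ℝ}
    (hf : ∀ u v, G.Adj u v → ∃ m : ℤ, |f v - f u - 1 / 2 - m| ≤ ε) {u v : V} (p : G.Walk u v)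
    (hp : Odd p.length) :
    ∃ m : ℤ, |f v - f u - 1 / 2 - m| ≤ p.length * ε := by
  obtain ⟨m, hm⟩ := walk_label_error hf p
  obtain ⟨j, hj⟩ := hp
  refine ⟨m + j, ?_⟩
  convert hm using 2
  rw [hj]
  push_cast
  ring

/-- The label returns to its starting value, so the accumulated error must absorb a half-integer. -/
lemma HasCircularLabelling.half_le_of_odd_closed {ε : ℝ} (h : HasCircularLabelling G ε) {u : V}
    (p : G.Walk u u) (hp : Odd p.length) : 1 / 2 ≤ p.length * ε := by
  obtain ⟨f, hf⟩ := h
  obtain ⟨m, hm⟩ := walk_label_error_of_odd hf p hp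
  refine le_trans ?_ hm
  rcases le_or_gt 0 m with h0 | h0
  · have : (0 : ℝ) ≤ m := by exact_mod_cast h0
    rw [abs_of_nonpos (by linarith)]
    linarith
  · have : (m : ℝ) ≤ -1 := by exact_mod_cast (by omega : m ≤ -1)
    rw [abs_of_nonneg (by linarith)]
    linarith

lemma HasCircularLabelling.power {ε : ℝ} (h : HasCircularLabelling G ε) {k : ℕ} (hk : Odd k) :
    HasCircularLabelling (power G k) (k * ε) := by
  obtain ⟨f, hf⟩ := h
  refine ⟨f, fun u v huv => ?_⟩
  obtain ⟨-, p, rfl⟩ := huv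
  exact walk_label_error_of_odd hf p hk

/-- The sum of an edge weight along a walk. -/
def walkSum (a : V → V → ℝ) : ∀ {u v : V}, G.Walk u v → ℝ
  | _, _, .nil => 0
  | u, _, .cons (v := w) _ p => a u w + walkSum a p

lemma walkSum_split (a : V → V → ℝ) (n : ℕ) {u v : V} (p : G.Walk u v) (hn : n ≤ p.length) :
    ∃ (w : V) (q : G.Walk u w) (r : G.Walk w v), q.length = n ∧ n + r.length = p.length ∧
      walkSum a p = walkSum a q + walkSum a r := by
  induction n generalizing u with
  | zero => exact ⟨u, .nil, p, rfl, by simp, by simp [walkSum]⟩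
  | succ n ih =>
    cases p with
    | nil => simp at hn
    | cons h p =>
      obtain ⟨w, q, r, hq, hr, hs⟩ := ih p (by simpa using hn)
      exact ⟨w, .cons h q, r, by simp [hq], by simp; omega, by simp [walkSum, hs, add_assoc]⟩

lemma abs_walkSum_le {a : V → V → ℝ} {ε : ℝ} (ha : ∀ u v, G.Adj u v → |a u v| ≤ ε) {u v : V}
    (p : G.Walk u v) : |walkSum a p| ≤ p.length * ε := by
  induction p with
  | nil => simp [walkSum]
  | @cons x y z h p ih =>
    simp only [walkSum, Walk.length_cons, Nat.cast_add, Nat.cast_one]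
    linarith [abs_add_le (a x y) (walkSum a p), ha x y h]

/-- A weight whose sum along every walk of length `k` is at most `ε` can be changed by a potential
so that it is at most `ε / k` on every edge. -/
lemma exists_potential {a : V → V → ℝ} {ε : ℝ} {k : ℕ} (hk : 0 < k) (hε : 0 ≤ ε)
    (ha : ∀ u v, G.Adj u v → |a u v| ≤ ε)
    (hs : ∀ (u v : V) (p : G.Walk u v), p.length = k → walkSum a p ≤ ε) :
    ∃ h : V → ℝ, ∀ u v, G.Adj u v → a u v + h u - h v ≤ ε / k := by
  have hk' : (0 : ℝ) < k := by exact_mod_cast hk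
  -- Peel off blocks of length `k`, each of sum at most `ε = k * (ε / k)`; the remainder, shorter
  -- than `k`, costs at most `k * ε`.
  have bound : ∀ (n : ℕ) (u v : V) (p : G.Walk u v), p.length = n →
      walkSum a p ≤ n * (ε / k) + k * ε := by
    intro n
    induction n using Nat.strong_induction_on with
    | _ n ih =>
      intro u v p hp
      rcases lt_or_ge n k with hnk | hnk
      · have h1 := (le_abs_self _).trans (abs_walkSum_le ha p)
        rw [hp] at h1
        have h2 : (n : ℝ) * ε ≤ k * ε := by gcongr
        have h3 : 0 ≤ (n : ℝ) * (ε / k) := by positivity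
        linarith
      · obtain ⟨w, q, r, hq, hr, hqr⟩ := walkSum_split a k p (by omega)
        have h1 := hs _ _ q hq
        have h2 := ih r.length (by omega) _ _ r rfl
        have h3 : (n : ℝ) = k + r.length := by rw [← hp, ← hr]; push_cast; ring
        have h4 : (k : ℝ) * (ε / k) = ε := by field_simp
        rw [hqr, h3, add_mul, h4]
        linarith
  -- The infimum of `S u` is a shortest-path potential for the edge weight `ε / k - a`; `bound`
  -- keeps it finite even where this weight is negative.
  let S : V → Set ℝ := fun u => {x | ∃ (v : V) (p : G.Walk u v), x = p.length * (ε / k) - walkSum a p}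
  have hbdd : ∀ u, BddBelow (S u) := by
    refine fun u => ⟨-(k * ε), ?_⟩
    rintro x ⟨v, p, rfl⟩
    linarith [bound _ _ _ p rfl]
  have hne : ∀ u, (S u).Nonempty := fun u => ⟨_, u, .nil, rfl⟩
  refine ⟨fun u => sInf (S u), fun u v huv => ?_⟩
  have : sInf (S u) - ε / k + a u v ≤ sInf (S v) := by
    refine le_csInf (hne v) ?_
    rintro x ⟨w, p, rfl⟩
    have h1 := csInf_le (hbdd u) ⟨w, .cons huv p, rfl⟩
    simp only [walkSum, Walk.length_cons, Nat.cast_add, Nat.cast_one] at h1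
    linarith
  linarith

lemma exists_walk_add_two {u v : V} (p : G.Walk u v) (hp : 0 < p.length) (i : ℕ) :
    ∃ q : G.Walk u v, q.length = p.length + 2 * i := by
  cases p with
  | nil => simp at hp
  | cons h p =>
    induction i with
    | zero => exact ⟨.cons h p, rfl⟩
    | succ i ih =>
      obtain ⟨q, hq⟩ := ih
      exact ⟨.cons h (.cons h.symm q), by simp [hq]; ring⟩

lemma round_eq_of_abs_sub_lt {x : ℝ} {m : ℤ} (h : |x - m| < 1 / 2) : round x = m := by
  rw [abs_lt] at h
  rw [round_eq, Int.floor_eq_iff]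
  constructor <;> linarith [h.1, h.2]

/-- The signed errors of a labelling of the power form an antisymmetric edge weight on `G`. Its sums
along walks of length `k` are at most `ε`, so `exists_potential` corrects the labels, and
antisymmetry makes the resulting bound two-sided. -/
lemma HasCircularLabelling.of_power {ε : ℝ} {k : ℕ} (hk : Odd k)
    (h : HasCircularLabelling (GraphPower.power G k) ε) (hε0 : 0 ≤ ε) (hε : ε < 1 / 4)
    (hclosed : ∀ (u : V) (p : G.Walk u u), p.length ≠ k) :
    HasCircularLabelling G (ε / k) := by
  obtain ⟨f, hf⟩ := h
  -- Pad the walk to length `k` by backtracking; `hclosed` ensures that its ends are distinct, as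
  -- adjacency in the power requires.
  have hodd : ∀ (u v : V) (p : G.Walk u v), Odd p.length → p.length ≤ k →
      ∃ m : ℤ, |f v - f u - 1 / 2 - m| ≤ ε := by
    intro u v p hp hpk
    obtain ⟨i, hi⟩ := hp
    obtain ⟨j, hj⟩ := hk
    obtain ⟨q, hq⟩ := exists_walk_add_two p (by omega) (j - i)
    have hqk : q.length = k := by omega
    refine hf u v ⟨?_, q, hqk⟩
    rintro rfl
    exact hclosed u q hqk
  let a : V → V → ℝ := fun u v => f v - f u - 1 / 2 - round (f v - f u - 1 / 2)
  have ha : ∀ u v, G.Adj u v → |a u v| ≤ ε := by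
    intro u v huv
    obtain ⟨m, hm⟩ := hodd u v (.cons huv .nil) (by simp)
      (by simpa [Nat.one_le_iff_ne_zero] using hk.pos.ne')
    have := round_eq_of_abs_sub_lt (x := f v - f u - 1 / 2) (m := m) (by linarith)
    simp only [a, this]
    exact hm
  have hanti : ∀ u v, G.Adj u v → a v u = -a u v := by
    intro u v huv
    have h1 := ha u v huv
    have : round (f u - f v - 1 / 2) = -round (f v - f u - 1 / 2) - 1 := by
      apply round_eq_of_abs_sub_lt
      push_cast
      rw [← abs_neg]
      refine lt_of_le_of_lt (le_of_eq ?_) (lt_of_le_of_lt h1 (by linarith))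
      simp only [a]
      congr 1
      ring
    simp only [a, this]
    push_cast
    ring
  have hint : ∀ (u v : V) (p : G.Walk u v), ∃ m : ℤ,
      walkSum a p = f v - f u - p.length / 2 - m := by
    intro u v p
    induction p with
    | nil => exact ⟨0, by simp [walkSum]⟩
    | @cons x y z h p ih =>
      obtain ⟨m, hm⟩ := ih
      refine ⟨m + round (f y - f x - 1 / 2), ?_⟩
      simp only [walkSum, hm, a, Walk.length_cons]
      push_cast
      ring
  have hsum : ∀ (i : ℕ) (u v : V) (p : G.Walk u v), p.length = 2 * i + 1 → 2 * i + 1 ≤ k →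
      |walkSum a p| ≤ ε := by
    intro i
    induction i with
    | zero =>
      intro u v p hp _
      have := abs_walkSum_le ha p
      rwa [hp, mul_zero, zero_add, Nat.cast_one, one_mul] at this
    | succ i ih =>
      intro u v p hp hik
      obtain ⟨w, q, r, hq, hr, hqr⟩ := walkSum_split a 2 p (by omega)
      have h1 := abs_walkSum_le ha q
      have h2 := ih _ _ r (by omega) (by omega)
      rw [hq] at h1
      have h3 : |walkSum a p| ≤ 3 * ε := by
        rw [hqr]
        push_cast at h1
        linarith [abs_add_le (walkSum a q) (walkSum a r)]
      obtain ⟨m, hm⟩ := hodd u v p ⟨i + 1, hp⟩ (by omega)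
      obtain ⟨n, hn⟩ := hint u v p
      have h4 : f v - f u - 1 / 2 - m = walkSum a p - ((m - n - (i + 1) : ℤ) : ℝ) := by
        rw [hn, hp]
        push_cast
        ring
      rw [h4] at hm
      -- An integer of absolute value at most `3 * ε + ε < 1`: this is where the threshold 1/4 comes
      -- from.
      have h5 : m - n - (i + 1) = 0 := by
        rw [← Int.abs_lt_one_iff]
        have : |((m - n - (i + 1) : ℤ) : ℝ)| < 1 := by
          rw [abs_le] at hm h3
          rw [abs_lt]
          constructor <;> linarith [hm.1, hm.2, h3.1, h3.2]
        exact_mod_cast this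
      rw [h5] at hm
      simpa using hm
  obtain ⟨h, hh⟩ := exists_potential hk.pos hε0 ha (fun u v p hp => by
    obtain ⟨j, hj⟩ := hk
    exact (le_abs_self _).trans (hsum j u v p (by omega) hj.ge))
  refine ⟨fun v => f v - h v, fun u v huv => ⟨round (f v - f u - 1 / 2), ?_⟩⟩
  have h1 := hh u v huv
  have h2 := hh v u huv.symm
  rw [hanti u v huv] at h2
  simp only [a] at h1 h2
  rw [abs_le]
  constructor <;> linarith

end Labelling

/-! ### Odd closed walks contain odd cycles -/

section OddCycle

variable {V : Type v} {G : SimpleGraph V}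

/-- Each loop cut out by `bypass` is an edge followed by a path back. If the path is even it cannot
be that edge itself, so the loop is an odd cycle; if it is odd, cutting preserves parity. -/
lemma exists_odd_cycle_or_bypass_parity [DecidableEq V] {u v : V} (p : G.Walk u v) :
    (∃ (x : V) (c : G.Walk x x), c.IsCycle ∧ Odd c.length ∧ c.length ≤ p.length) ∨
      p.bypass.length % 2 = p.length % 2 := by
  induction p with
  | nil => right; rfl
  | @cons a b c h p ih =>
    rcases ih with ⟨x, w, hw, hodd, hle⟩ | ih
    · exact Or.inl ⟨x, w, hw, hodd, hle.trans (by simp)⟩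
    by_cases hs : a ∈ p.bypass.support
    · have hlen := congrArg Walk.length (p.bypass.take_spec hs)
      rw [Walk.length_append] at hlen
      have hpath : (p.bypass.takeUntil a hs).IsPath := p.bypass_isPath.takeUntil hs
      have hle := p.length_bypass_le_length
      rcases Nat.even_or_odd (p.bypass.takeUntil a hs).length with he | ho
      · left
        refine ⟨a, .cons h (p.bypass.takeUntil a hs), ?_, ?_, ?_⟩
        · rw [Walk.cons_isCycle_iff]
          refine ⟨hpath, fun hmem => ?_⟩
          rw [Sym2.eq_swap] at hmem
          rw [hpath.length_eq_one_of_mem_edges hmem] at he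
          exact absurd he (by decide)
        · simpa using he.add_one
        · simp only [Walk.length_cons]
          omega
      · right
        simp only [Walk.bypass, hs, dite_true, Walk.length_cons]
        obtain ⟨i, hi⟩ := ho
        omega
    · right
      simp only [Walk.bypass, hs, dite_false, Walk.length_cons]
      omega

lemma exists_odd_cycle_le {u : V} (p : G.Walk u u) (hp : Odd p.length) :
    ∃ (x : V) (c : G.Walk x x), c.IsCycle ∧ Odd c.length ∧ c.length ≤ p.length := by
  classical
  refine (exists_odd_cycle_or_bypass_parity p).resolve_right fun h => ?_
  have h0 : p.bypass.length = 0 :=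
    Walk.length_eq_zero_iff.2 (Walk.isPath_iff_nil.1 p.bypass_isPath)
  rw [h0] at h
  obtain ⟨i, hi⟩ := hp
  omega

lemma oddGirth_le_of_odd_closed {u : V} (p : G.Walk u u) (hp : Odd p.length) :
    oddGirth G ≤ p.length := by
  obtain ⟨x, c, hc, ho, hle⟩ := exists_odd_cycle_le p hp
  refine le_trans ?_ (Nat.cast_le.2 hle)
  exact iInf_le_of_le x (iInf_le_of_le c (iInf_le_of_le hc (iInf_le _ ho)))

end OddCycle

/-! ### Subdivisions: labellings and closed walks -/

section Subdivision

variable {V : Type v} {G : SimpleGraph V} {m : ℕ}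

lemma adj_out (e : G.edgeSet) : G.Adj (Quot.out e.1).1 (Quot.out e.1).2 := by
  have h : s((Quot.out e.1).1, (Quot.out e.1).2) = e.1 := Quot.out_eq e.1
  rw [← mem_edgeSet, h]
  exact e.2

lemma out_eq_or (u v : V) :
    (Quot.out s(u, v)) = (u, v) ∨ (Quot.out s(u, v)) = (v, u) := by
  have h' : s((Quot.out s(u, v)).1, (Quot.out s(u, v)).2) = s(u, v) := Quot.out_eq s(u, v)
  rw [Sym2.eq_iff] at h'
  exact h'.imp (fun hl => Prod.ext hl.1 hl.2) (fun hr => Prod.ext hr.1 hr.2)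

lemma pathVertex_zero (e : G.edgeSet) : pathVertex G m e 0 = Sum.inl (Quot.out e.1).1 := by
  simp [pathVertex]

lemma pathVertex_last (hm : 0 < m) (e : G.edgeSet) :
    pathVertex G m e m = Sum.inl (Quot.out e.1).2 := by
  simp [pathVertex, hm.ne']

lemma pathVertex_inner {i : ℕ} (h0 : 0 < i) (hi : i < m) (e : G.edgeSet) :
    pathVertex G m e i = Sum.inr (e, ⟨i - 1, by omega⟩) := by
  have : i - 1 < m - 1 := by omega
  simp [pathVertex, h0.ne', this]

/-- Two positions on subdivided edges give the same vertex only if they are the same position, or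
both are ends of their paths. -/
lemma pathVertex_eq {e e' : G.edgeSet} {i i' : ℕ} (hi : i ≤ m) (hi' : i' ≤ m)
    (h : pathVertex G m e i = pathVertex G m e' i') :
    (e = e' ∧ i = i') ∨ ((i = 0 ∨ i = m) ∧ (i' = 0 ∨ i' = m)) := by
  by_cases h1 : i = 0 ∨ i = m
  · by_cases h2 : i' = 0 ∨ i' = m
    · exact Or.inr ⟨h1, h2⟩
    · rw [pathVertex_inner (i := i') (by omega) (by omega)] at h
      rcases h1 with rfl | rfl
      · simp [pathVertex_zero] at h
      · simp [pathVertex_last (show 0 < i by omega)] at h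
  · rw [pathVertex_inner (i := i) (by omega) (by omega)] at h
    by_cases h2 : i' = 0 ∨ i' = m
    · rcases h2 with rfl | rfl
      · simp [pathVertex_zero] at h
      · simp [pathVertex_last (show 0 < i' by omega)] at h
    · rw [pathVertex_inner (i := i') (by omega) (by omega)] at h
      simp only [Sum.inr.injEq, Prod.mk.injEq, Fin.mk.injEq] at h
      exact Or.inl ⟨h.1, by omega⟩

lemma subdivision_adj_succ {i : ℕ} (hi : i < m) (e : G.edgeSet) :
    (subdivision G m).Adj (pathVertex G m e i) (pathVertex G m e (i + 1)) := by
  refine ⟨fun h => ?_, e, i, hi, Or.inl ⟨rfl, rfl⟩⟩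
  rcases pathVertex_eq (by omega) (by omega) h with h' | ⟨h1, h2⟩
  · omega
  · obtain rfl : i = 0 := by omega
    obtain rfl : m = 1 := by omega
    rw [pathVertex_zero, zero_add, pathVertex_last one_pos] at h
    exact (adj_out e).ne (Sum.inl_injective h)

lemma exists_walk_pathVertex (e : G.edgeSet) (i : ℕ) (hi : i ≤ m) :
    ∃ p : (subdivision G m).Walk (pathVertex G m e 0) (pathVertex G m e i), p.length = i := by
  induction i with
  | zero => exact ⟨.nil, rfl⟩
  | succ i ih =>
    obtain ⟨p, hp⟩ := ih (by omega)
    exact ⟨p.concat (subdivision_adj_succ (by omega) e), by simp [hp]⟩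

lemma exists_walk_subdivision (hm : 0 < m) {u v : V} (h : G.Adj u v) :
    ∃ p : (subdivision G m).Walk (Sum.inl u) (Sum.inl v), p.length = m := by
  obtain ⟨p, hp⟩ := exists_walk_pathVertex ⟨s(u, v), h⟩ m le_rfl
  have h0 := pathVertex_zero (m := m) (⟨s(u, v), h⟩ : G.edgeSet)
  have h1 := pathVertex_last hm (⟨s(u, v), h⟩ : G.edgeSet)
  rcases out_eq_or u v with h' | h' <;> simp only [h'] at h0 h1
  · exact ⟨p.copy h0 h1, by simpa using hp⟩
  · exact ⟨(p.copy h0 h1).reverse, by simpa using hp⟩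

lemma HasCircularLabelling.of_subdivision {ε : ℝ} (hm : Odd m)
    (h : HasCircularLabelling (subdivision G m) ε) : HasCircularLabelling G (m * ε) := by
  obtain ⟨f, hf⟩ := h
  refine ⟨fun v => f (Sum.inl v), fun u v huv => ?_⟩
  obtain ⟨p, hp⟩ := exists_walk_subdivision hm.pos huv
  have h := walk_label_error_of_odd hf p (by rwa [hp])
  rwa [hp] at h

/-- Interpolate along each path with constant step `1 / 2 + a e / m`. The total `m / 2 + a e` is
correct modulo 1 because `m` is odd. -/
lemma HasCircularLabelling.subdivision {ε : ℝ} (hm : Odd m)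
    (h : HasCircularLabelling G (m * ε)) : HasCircularLabelling (subdivision G m) ε := by
  obtain ⟨f, hf⟩ := h
  have hm0 : (0 : ℝ) < m := by exact_mod_cast hm.pos
  choose M hM using fun e : G.edgeSet => hf _ _ (adj_out e)
  let a : G.edgeSet → ℝ := fun e => f (Quot.out e.1).2 - f (Quot.out e.1).1 - 1 / 2 - M e
  let F : SubdivVertex G m → ℝ := Sum.elim f
    (fun x => f (Quot.out x.1.1).1 + ((x.2 : ℕ) + 1 : ℝ) * (1 / 2 + a x.1 / m))
  have hF : ∀ (e : G.edgeSet) (i : ℕ), i ≤ m → ∃ n : ℤ,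
      F (pathVertex G m e i) = f (Quot.out e.1).1 + i * (1 / 2 + a e / m) + n := by
    intro e i hi
    rcases Nat.eq_zero_or_pos i with rfl | h0
    · exact ⟨0, by simp [pathVertex_zero, F]⟩
    rcases hi.lt_or_eq with him | rfl
    · refine ⟨0, ?_⟩
      rw [pathVertex_inner h0 him]
      have : ((i - 1 : ℕ) : ℝ) + 1 = i := by
        rw [Nat.cast_sub h0]
        simp
      simp [F, this]
    · obtain ⟨j, hj⟩ := hm
      refine ⟨M e - j, ?_⟩
      have h1 : (i : ℝ) * (1 / 2 + a e / i) = i / 2 + a e := by field_simp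
      have h2 : (i : ℝ) = 2 * j + 1 := by rw [hj]; push_cast; ring
      rw [pathVertex_last h0, h1, h2]
      simp only [F, a, Sum.elim_inl]
      push_cast
      ring
  have hae : ∀ e, |a e / m| ≤ ε := by
    intro e
    rw [abs_div, abs_of_pos hm0, div_le_iff₀ hm0, mul_comm ε]
    exact hM e
  have key : ∀ (e : G.edgeSet) (i : ℕ), i < m → ∃ n : ℤ,
      F (pathVertex G m e (i + 1)) - F (pathVertex G m e i) - 1 / 2 - n = a e / m := by
    intro e i hi
    obtain ⟨n, hn⟩ := hF e i hi.le
    obtain ⟨n', hn'⟩ := hF e (i + 1) hi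
    refine ⟨n' - n, ?_⟩
    rw [hn, hn']
    push_cast
    ring
  refine ⟨F, ?_⟩
  rintro x y ⟨-, e, i, hi, ⟨rfl, rfl⟩ | ⟨rfl, rfl⟩⟩
  · obtain ⟨n, hn⟩ := key e i hi
    exact ⟨n, hn ▸ hae e⟩
  · obtain ⟨n, hn⟩ := key e i hi
    refine ⟨-n - 1, ?_⟩
    rw [← abs_neg]
    convert hae e using 2
    rw [← hn]
    push_cast
    ring

/-- A closed walk of odd length `n` in the `m`-subdivision, `m` odd, yields an odd closed walk in
the graph itself whose length is at most `n / m`. -/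
lemma exists_odd_closed_of_subdivision (hm : Odd m) {x : SubdivVertex G m}
    (w : (subdivision G m).Walk x x) (hw : Odd w.length) :
    ∃ (u : V) (p : G.Walk u u), Odd p.length ∧ p.length * m ≤ w.length := by
  have hpos : 0 < m := hm.pos
  obtain ⟨e₀, i₀, hi₀, rfl⟩ : ∃ (e : G.edgeSet) (i : ℕ), i ≤ m ∧ x = pathVertex G m e i := by
    cases w with
    | nil => simp at hw
    | cons h p =>
      obtain ⟨-, e, i, hi, ⟨h1, -⟩ | ⟨-, h1⟩⟩ := h
      · exact ⟨e, i, hi.le, h1⟩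
      · exact ⟨e, i + 1, hi, h1⟩
  -- Lengths `n` of walks from the base point to `v` that leave `e₀` through its first or second
  -- end; `t` counts wasted back-and-forth pairs.
  let S : V → ℕ → Prop := fun v n =>
    (∃ (p : G.Walk (Quot.out e₀.1).1 v) (t : ℕ), p.length * m + i₀ + 2 * t = n) ∨
      (∃ (p : G.Walk (Quot.out e₀.1).2 v) (t : ℕ), p.length * m + m + 2 * t = n + i₀)
  have S_add_two : ∀ v n, S v n → S v (n + 2) := by
    rintro v n (⟨p, t, h⟩ | ⟨p, t, h⟩)
    · exact Or.inl ⟨p, t + 1, by omega⟩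
    · exact Or.inr ⟨p, t + 1, by omega⟩
  have S_adj : ∀ u v n, G.Adj u v → S u n → S v (n + m) := by
    rintro u v n huv (⟨p, t, h⟩ | ⟨p, t, h⟩)
    · exact Or.inl ⟨p.concat huv, t, by rw [Walk.length_concat, add_mul]; omega⟩
    · exact Or.inr ⟨p.concat huv, t, by rw [Walk.length_concat, add_mul]; omega⟩
  -- Position `i` on `e` is entered from the first end, from the second end, or without ever leaving
  -- `e₀`. This is invariant along walks, and at path ends it depends only on the vertex
  -- (`L_congr`).
  let L : G.edgeSet → ℕ → ℕ → Prop := fun e i n =>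
    (∃ a, S (Quot.out e.1).1 a ∧ n = a + i) ∨ (∃ a, S (Quot.out e.1).2 a ∧ n + i = a + m) ∨
      (e = e₀ ∧ Even (i + i₀ + n) ∧ i ≤ i₀ + n ∧ i₀ ≤ i + n)
  have L_zero : ∀ e n, L e 0 n ↔ S (Quot.out e.1).1 n := by
    intro e n
    constructor
    · rintro (⟨a, ha, rfl⟩ | ⟨a, ha, h⟩ | ⟨rfl, ⟨t, ht⟩, -, h⟩)
      · exact ha
      · obtain rfl : n = a + m := h
        exact S_adj _ _ _ (adj_out e).symm ha
      · exact Or.inl ⟨.nil, t - i₀, by simp only [Walk.length_nil, zero_mul]; omega⟩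
    · exact fun h => Or.inl ⟨n, h, rfl⟩
  have L_last : ∀ e n, L e m n ↔ S (Quot.out e.1).2 n := by
    intro e n
    constructor
    · rintro (⟨a, ha, rfl⟩ | ⟨a, ha, h⟩ | ⟨rfl, ⟨t, ht⟩, h, -⟩)
      · exact S_adj _ _ _ (adj_out e) ha
      · obtain rfl : n = a := by omega
        exact ha
      · exact Or.inr ⟨.nil, t - m, by simp only [Walk.length_nil, zero_mul]; omega⟩
    · exact fun h => Or.inr (Or.inl ⟨n, h, rfl⟩)
  have L_succ : ∀ e i n, L e i n → L e (i + 1) (n + 1) := by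
    rintro e i n (⟨a, ha, rfl⟩ | ⟨a, ha, h⟩ | ⟨rfl, ⟨t, ht⟩, h, h'⟩)
    · exact Or.inl ⟨a, ha, by omega⟩
    · exact Or.inr (Or.inl ⟨a + 2, S_add_two _ _ ha, by omega⟩)
    · exact Or.inr (Or.inr ⟨rfl, ⟨t + 1, by omega⟩, by omega, by omega⟩)
  have L_pred : ∀ e i n, L e (i + 1) n → L e i (n + 1) := by
    rintro e i n (⟨a, ha, rfl⟩ | ⟨a, ha, h⟩ | ⟨rfl, ⟨t, ht⟩, h, h'⟩)
    · exact Or.inl ⟨a + 2, S_add_two _ _ ha, by omega⟩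
    · exact Or.inr (Or.inl ⟨a, ha, by omega⟩)
    · exact Or.inr (Or.inr ⟨rfl, ⟨t, by omega⟩, by omega, by omega⟩)
  have L_congr : ∀ e i e' i' n, i ≤ m → i' ≤ m → pathVertex G m e i = pathVertex G m e' i' →
      L e i n → L e' i' n := by
    intro e i e' i' n hi hi' h hL
    rcases pathVertex_eq hi hi' h with ⟨rfl, rfl⟩ | ⟨rfl | rfl, rfl | rfl⟩
    · exact hL
    · rw [L_zero] at hL ⊢
      rw [pathVertex_zero, pathVertex_zero] at h
      exact Sum.inl_injective h ▸ hL
    · rw [L_zero] at hL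
      rw [L_last]
      rw [pathVertex_zero, pathVertex_last hpos] at h
      exact Sum.inl_injective h ▸ hL
    · rw [L_last] at hL
      rw [L_zero]
      rw [pathVertex_zero, pathVertex_last hpos] at h
      exact Sum.inl_injective h ▸ hL
    · rw [L_last] at hL ⊢
      rw [pathVertex_last hpos, pathVertex_last hpos] at h
      exact Sum.inl_injective h ▸ hL
  have walk : ∀ (y z : SubdivVertex G m) (p : (GraphPower.subdivision G m).Walk y z) (n : ℕ),
      (∃ e i, i ≤ m ∧ y = pathVertex G m e i ∧ L e i n) →
      ∃ e i, i ≤ m ∧ z = pathVertex G m e i ∧ L e i (n + p.length) := by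
    intro y z p
    induction p with
    | nil => exact fun n h => h
    | @cons y y' z h p ih =>
      rintro n ⟨e, i, hi, rfl, hL⟩
      rw [Walk.length_cons, add_comm p.length, ← add_assoc]
      apply ih
      obtain ⟨-, e', i', hi', ⟨h1, h2⟩ | ⟨h1, h2⟩⟩ := h
      · exact ⟨e', i' + 1, hi', h2, L_succ _ _ _ (L_congr _ _ _ _ _ hi hi'.le h1 hL)⟩
      · exact ⟨e', i', hi'.le, h1, L_pred _ _ _ (L_congr _ _ _ _ _ hi hi' h2 hL)⟩
  obtain ⟨e, i, hi, h, hL⟩ := walk _ _ w 0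
    ⟨e₀, i₀, hi₀, rfl, Or.inr (Or.inr ⟨rfl, ⟨i₀, by omega⟩, by omega, by omega⟩)⟩
  have hL' := L_congr _ _ _ _ _ hi hi₀ h.symm hL
  rw [zero_add] at hL'
  have hodd : ∀ l t : ℕ, l * m + 2 * t = w.length → Odd l := by
    intro l t h
    have : Odd (l * m) := by
      obtain ⟨j, hj⟩ := hw
      exact ⟨j - t, by omega⟩
    exact (Nat.odd_mul.1 this).1
  -- If the walk leaves and re-enters `e₀` through different ends, the edge itself closes `p`; a
  -- walk that never leaves `e₀` is even.
  rcases hL' with ⟨a, ⟨p, t, hp⟩ | ⟨p, t, hp⟩, ha⟩ | ⟨a, ⟨p, t, hp⟩ | ⟨p, t, hp⟩, ha⟩ |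
    ⟨-, ⟨t, ht⟩, -⟩
  · exact ⟨_, p, hodd _ (i₀ + t) (by omega), by omega⟩
  · have hl : (p.concat (adj_out e₀)).length * m + 2 * t = w.length := by
      rw [Walk.length_concat, add_mul]
      omega
    exact ⟨_, p.concat (adj_out e₀), hodd _ t hl, by omega⟩
  · have hl : (p.concat (adj_out e₀).symm).length * m + 2 * t = w.length := by
      rw [Walk.length_concat, add_mul]
      omega
    exact ⟨_, p.concat (adj_out e₀).symm, hodd _ t hl, by omega⟩
  · exact ⟨_, p, hodd _ (m - i₀ + t) (by omega), by omega⟩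
  · obtain ⟨j, hj⟩ := hw
    omega

lemma subdivision_walk_length_ne {k : ℕ} (hm : Odd m) (hk : Odd k)
    (hog : (k : ℕ∞) < m * oddGirth G) (x : SubdivVertex G m)
    (w : (subdivision G m).Walk x x) : w.length ≠ k := by
  rintro rfl
  obtain ⟨u, p, hp, hle⟩ := exists_odd_closed_of_subdivision hm w hk
  refine hog.not_ge ?_
  calc (m : ℕ∞) * oddGirth G ≤ m * p.length := by gcongr; exact oddGirth_le_of_odd_closed p hp
    _ = ((p.length * m : ℕ) : ℕ∞) := by push_cast; ring
    _ ≤ w.length := by exact_mod_cast hle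

lemma HasCircularLabelling.lt_mul_oddGirth {k : ℕ} (hm : 0 < m) (hk : 0 < k)
    (h : HasCircularLabelling G (m / (6 * k))) : (k : ℕ∞) < m * oddGirth G := by
  have hk' : (0 : ℝ) < k := by exact_mod_cast hk
  have hcycle : ∀ (u : V) (p : G.Walk u u), Odd p.length → 3 * k ≤ p.length * m := by
    intro u p hp
    have := h.half_le_of_odd_closed p hp
    rw [← mul_div_assoc, le_div_iff₀ (by positivity)] at this
    have h3 : (3 * k : ℝ) ≤ p.length * m := by linarith
    exact_mod_cast h3
  -- An integer lower bound gives strictness also when the odd girth is `⊤`.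
  have hle : ((k / m + 1 : ℕ) : ℕ∞) ≤ oddGirth G := by
    refine le_iInf fun u => le_iInf fun p => le_iInf fun _ => le_iInf fun hp => ?_
    have := hcycle u p hp
    rw [Nat.cast_le, Nat.succ_le_iff, Nat.div_lt_iff_lt_mul hm]
    omega
  calc (k : ℕ∞) < ((m * (k / m + 1) : ℕ) : ℕ∞) := by
        rw [Nat.cast_lt, mul_comm, ← Nat.div_lt_iff_lt_mul hm]
        exact Nat.lt_succ_self _
    _ = m * ((k / m + 1 : ℕ) : ℕ∞) := by push_cast; ring
    _ ≤ m * oddGirth G := by gcongr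

lemma hasCircularLabelling_fracPower_iff {k : ℕ} (hm : Odd m) (hk : Odd k)
    (hog : (k : ℕ∞) < m * oddGirth G) {ε : ℝ} (hε0 : 0 ≤ ε) (hε : ε < 1 / 4) :
    HasCircularLabelling (fracPower G k m) ε ↔ HasCircularLabelling G (m * (ε / k)) := by
  constructor
  · intro h
    exact (HasCircularLabelling.of_power hk h hε0 hε
      (subdivision_walk_length_ne hm hk hog)).of_subdivision hm
  · intro h
    have hk' : (k : ℝ) ≠ 0 := by exact_mod_cast hk.pos.ne'
    have := (h.subdivision hm).power hk
    rwa [mul_div_cancel₀ _ hk'] at this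

end Subdivision

/-! ### Labellings, 3-colourings and homomorphisms to K_{n/d} -/

section Coloring

variable {V : Type v} {G : SimpleGraph V}

/-- Colours are thirds of the circle. Conversely, error at most 1/6 puts neighbours at distance at
least 1/3, so they never share a half-open arc of length 1/3. -/
lemma colorable_three_iff : G.Colorable 3 ↔ HasCircularLabelling G (1 / 6) := by
  constructor
  · rintro ⟨c⟩
    refine ⟨fun v => ((c v : ℕ) : ℝ) / 3, fun u v huv => ?_⟩
    have hne : (c u : ℕ) ≠ (c v : ℕ) := fun h => c.valid huv (Fin.ext h)
    have hu := (c u).isLt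
    have hv := (c v).isLt
    beta_reduce
    generalize ((c u : Fin 3) : ℕ) = x at *
    generalize ((c v : Fin 3) : ℕ) = y at *
    rcases hne.lt_or_gt with h | h
    · refine ⟨0, ?_⟩
      have h1 : (x : ℝ) + 1 ≤ y := by exact_mod_cast h
      have h2 : (y : ℝ) ≤ x + 2 := by exact_mod_cast (by omega : y ≤ x + 2)
      rw [abs_le]
      push_cast
      constructor <;> linarith
    · refine ⟨-1, ?_⟩
      have h1 : (y : ℝ) + 1 ≤ x := by exact_mod_cast h
      have h2 : (x : ℝ) ≤ y + 2 := by exact_mod_cast (by omega : x ≤ y + 2)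
      rw [abs_le]
      push_cast
      constructor <;> linarith
  · rintro ⟨f, hf⟩
    let c : V → ZMod 3 := fun v => ((⌊3 * f v⌋ : ℤ) : ZMod 3)
    have hc : ∀ {u v : V}, G.Adj u v → c u ≠ c v := by
      intro u v huv h
      obtain ⟨m, hm⟩ := hf u v huv
      obtain ⟨j, hj⟩ := (ZMod.intCast_eq_intCast_iff_dvd_sub _ _ 3).1 h
      have hj' : (⌊3 * f v⌋ : ℝ) - ⌊3 * f u⌋ = 3 * j := by exact_mod_cast hj
      have h1 := Int.floor_le (3 * f u)
      have h2 := Int.lt_floor_add_one (3 * f u)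
      have h3 := Int.floor_le (3 * f v)
      have h4 := Int.lt_floor_add_one (3 * f v)
      rw [abs_le] at hm
      have h5 : (m : ℝ) < j := by linarith [hm.1, hm.2]
      have h6 : (j : ℝ) < m + 1 := by linarith [hm.1, hm.2]
      have h5' : m < j := by exact_mod_cast h5
      have h6' : j < m + 1 := by exact_mod_cast h6
      omega
    exact (Coloring.mk c hc).colorable

lemma chi_le_iff [Finite V] {n : ℕ} : chi G ≤ n ↔ G.Colorable n := by
  constructor
  · exact fun h => (colorable_chromaticNumber_of_fintype G).mono h
  · intro h
    exact ENat.toNat_le_of_le_natCast h.chromaticNumber_le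

/-- A homomorphism to `K_{n/d}` gives a circular labelling with error `1 / 2 - d / n`. -/
lemma HasCircularLabelling.of_hom {n d : ℕ} (hn : 0 < n) (φ : G →g circularComplete n d) :
    HasCircularLabelling G (1 / 2 - d / n) := by
  refine ⟨fun v => ((φ v : ℕ) : ℝ) / n, fun u v huv => ?_⟩
  obtain ⟨-, h1, h2⟩ := φ.map_adj huv
  have hn' : (0 : ℝ) < n := by exact_mod_cast hn
  beta_reduce
  generalize ((φ u : Fin n) : ℕ) = x at *
  generalize ((φ v : Fin n) : ℕ) = y at *
  have h1' : (d : ℝ) ≤ |(x : ℝ) - y| := by exact_mod_cast h1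
  have h2' : |(x : ℝ) - y| ≤ n - d := by exact_mod_cast h2
  have key : ∀ z : ℝ, d ≤ z → z ≤ n - d → |z / n - 1 / 2| ≤ 1 / 2 - d / n := by
    intro z hz hz'
    have e1 : (d : ℝ) / n ≤ z / n := by gcongr
    have e2 : z / n ≤ (n - d) / n := by gcongr
    rw [sub_div, div_self hn'.ne'] at e2
    rw [abs_le]
    constructor <;> linarith
  rcases le_total x y with h | h
  · have h' : (x : ℝ) ≤ y := by exact_mod_cast h
    rw [abs_of_nonpos (by linarith)] at h1' h2'
    refine ⟨0, ?_⟩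
    convert key _ h1' h2' using 2
    push_cast
    ring
  · have h' : (y : ℝ) ≤ x := by exact_mod_cast h
    rw [abs_of_nonneg (by linarith)] at h1' h2'
    refine ⟨-1, ?_⟩
    rw [← abs_neg]
    convert key _ h1' h2' using 2
    push_cast
    ring

/-- A circular labelling with error at most `1 / 2 - d / n` gives a homomorphism to `K_{n/d}`. -/
lemma HasCircularLabelling.nonempty_hom {n d : ℕ} (hd : 0 < d) (hn : 0 < n)
    (h : HasCircularLabelling G (1 / 2 - d / n)) : Nonempty (G →g circularComplete n d) := by
  obtain ⟨f, hf⟩ := h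
  have hn' : (0 : ℝ) < n := by exact_mod_cast hn
  have hnz : (0 : ℤ) < n := by exact_mod_cast hn
  let c : V → ℤ := fun v => ⌊n * f v⌋ % n
  have hc0 : ∀ v, 0 ≤ c v := fun v => Int.emod_nonneg _ hnz.ne'
  have hcn : ∀ v, c v < n := fun v => Int.emod_lt_of_pos _ hnz
  -- Taking floors moves a difference by less than 1, so the integer bounds `d` and `n - d` survive.
  have hcd : ∀ u v, G.Adj u v → ∃ q : ℤ, d ≤ c v - c u + n * q ∧ c v - c u + n * q ≤ n - d := by
    intro u v huv
    obtain ⟨m, hm⟩ := hf u v huv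
    have hu := Int.emod_add_mul_ediv ⌊n * f u⌋ n
    have hv := Int.emod_add_mul_ediv ⌊n * f v⌋ n
    refine ⟨⌊n * f v⌋ / n - ⌊n * f u⌋ / n - m, ?_⟩
    have e : c v - c u + n * (⌊n * f v⌋ / n - ⌊n * f u⌋ / n - m) =
        ⌊n * f v⌋ - ⌊n * f u⌋ - n * m := by
      simp only [c]
      linear_combination hv - hu
    rw [e]
    have h1 := Int.floor_le (n * f u)
    have h2 := Int.lt_floor_add_one (n * f u)
    have h3 := Int.floor_le (n * f v)
    have h4 := Int.lt_floor_add_one (n * f v)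
    rw [abs_le] at hm
    have h5 : (d : ℝ) ≤ n * f v - n * f u - n * m := by
      have : (d : ℝ) / n ≤ f v - f u - m := by linarith [hm.1]
      rw [div_le_iff₀ hn'] at this
      linarith
    have h6 : n * f v - n * f u - n * m ≤ n - d := by
      have : (d : ℝ) / n ≤ 1 - (f v - f u - m) := by linarith [hm.2]
      rw [div_le_iff₀ hn'] at this
      linarith
    constructor
    · have : ((d : ℤ) : ℝ) - 1 < ((⌊n * f v⌋ - ⌊n * f u⌋ - n * m : ℤ) : ℝ) := by
        push_cast
        linarith
      have : (d : ℤ) - 1 < ⌊n * f v⌋ - ⌊n * f u⌋ - n * m := by exact_mod_cast this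
      omega
    · have : ((⌊n * f v⌋ - ⌊n * f u⌋ - n * m : ℤ) : ℝ) < ((n - d + 1 : ℤ) : ℝ) := by
        push_cast
        linarith
      have : ⌊n * f v⌋ - ⌊n * f u⌋ - n * m < (n - d + 1 : ℤ) := by exact_mod_cast this
      omega
  have hadj : ∀ u v, G.Adj u v → (d : ℤ) ≤ |c u - c v| ∧ |c u - c v| ≤ n - d := by
    intro u v huv
    obtain ⟨q, h1, h2⟩ := hcd u v huv
    have a1 := hc0 u
    have a2 := hcn u
    have a3 := hc0 v
    have a4 := hcn v
    have hd' : (0 : ℤ) < d := by exact_mod_cast hd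
    have hq1 : -1 < q := by
      by_contra hq
      have : (n : ℤ) * q ≤ n * (-1) := by gcongr; omega
      omega
    have hq2 : q < 2 := by
      by_contra hq
      have : (n : ℤ) * 2 ≤ n * q := by gcongr; omega
      omega
    rw [abs_sub_comm]
    obtain rfl | rfl : q = 0 ∨ q = 1 := by omega
    · rw [abs_of_nonneg (by omega)]
      omega
    · rw [abs_of_nonpos (by omega)]
      omega
  let g : V → Fin n := fun v => ⟨(c v).toNat, by have := hcn v; have := hc0 v; omega⟩
  have hg : ∀ v, ((g v : ℕ) : ℤ) = c v := fun v => Int.toNat_of_nonneg (hc0 v)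
  refine ⟨⟨g, fun {u v} huv => ?_⟩⟩
  obtain ⟨h1, h2⟩ := hadj u v huv
  refine ⟨fun h => ?_, ?_, ?_⟩
  · rw [← hg u, ← hg v, h] at h1
    simp only [sub_self, abs_zero] at h1
    omega
  · rwa [hg, hg]
  · rwa [hg, hg]

end Coloring

/-! ### Optimal errors, χ_c and μ -/

section CircularChromaticNumber

variable {V : Type v} {G : SimpleGraph V}

lemma exists_odd_closed (hG : ¬ G.IsBipartite) : ∃ (u : V) (p : G.Walk u u), Odd p.length := by
  by_contra! h
  exact hG (two_colorable_iff_forall_loop_even.2 fun u w => Nat.not_odd_iff_even.1 (h u w))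

lemma HasCircularLabelling.pos {ε : ℝ} (hG : ¬ G.IsBipartite) (h : HasCircularLabelling G ε) :
    0 < ε := by
  obtain ⟨u, p, hp⟩ := exists_odd_closed hG
  have h1 := h.half_le_of_odd_closed p hp
  by_contra! hε
  have : (p.length : ℝ) * ε ≤ 0 := mul_nonpos_of_nonneg_of_nonpos (by positivity) hε
  linarith

lemma exists_hom_circularComplete [Finite V] :
    ∃ n : ℕ, 2 ≤ n ∧ Nonempty (G →g circularComplete n 1) := by
  have := Fintype.ofFinite V
  let e := Fintype.equivFin V
  refine ⟨Fintype.card V + 2, by omega, ⟨⟨fun v => (e v).castAdd 2, fun {u v} huv => ?_⟩⟩⟩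
  have hne : (e u : ℕ) ≠ (e v : ℕ) := fun h => huv.ne (e.injective (Fin.ext h))
  have hu := (e u).isLt
  have hv := (e v).isLt
  refine ⟨fun h => hne ?_, ?_, ?_⟩
  · simpa using congrArg Fin.val h
  · simp only [Fin.val_castAdd, Nat.cast_one]
    exact Int.one_le_abs (by omega)
  · simp only [Fin.val_castAdd]
    rw [abs_le]
    push_cast
    omega

/-- The least error of a circular labelling is `1 / 2 - 1 / χ_c(G)`. -/
lemma isGLB_circularLabelling [Finite V] (hG : ¬ G.IsBipartite) :
    0 < circularChromaticNumber G ∧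
    IsGLB {ε | HasCircularLabelling G ε} (1 / 2 - 1 / circularChromaticNumber G) := by
  set X : Set ℝ := {x : ℝ | ∃ n d : ℕ, 0 < d ∧ 2 * d ≤ n ∧ Nonempty (G →g circularComplete n d) ∧
    x = (n : ℝ) / (d : ℝ)} with hX
  have hc : circularChromaticNumber G = sInf X := rfl
  have hne : X.Nonempty := by
    obtain ⟨n, hn, h⟩ := exists_hom_circularComplete (G := G)
    exact ⟨_, n, 1, one_pos, by omega, h, rfl⟩
  have hX2 : ∀ x ∈ X, 2 ≤ x := by
    rintro x ⟨n, d, hd, hn, -, rfl⟩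
    rw [le_div_iff₀ (by exact_mod_cast hd)]
    exact_mod_cast hn
  have hbdd : BddBelow X := ⟨2, hX2⟩
  have hc2 : 2 ≤ circularChromaticNumber G := le_csInf hne hX2
  have hXlab : ∀ x ∈ X, HasCircularLabelling G (1 / 2 - 1 / x) := by
    rintro x ⟨n, d, hd, hn, ⟨φ⟩, rfl⟩
    rw [one_div_div]
    exact .of_hom (by omega) φ
  refine ⟨by linarith, ?_, ?_⟩
  · intro ε hε
    have hcpos : 0 < circularChromaticNumber G := by linarith
    have hε0 := HasCircularLabelling.pos hG hε
    by_contra! hlt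
    set b := 1 / 2 - ε with hb
    have hcb : 1 < circularChromaticNumber G * b := by
      rw [← div_lt_iff₀' hcpos]
      linarith
    have hb0 : 0 < b := pos_of_mul_pos_right (one_pos.trans hcb) hcpos.le
    -- The first summand makes `n / ⌊n * b⌋₊` smaller than χ_c; the second keeps the floor positive.
    obtain ⟨n, hn⟩ := exists_nat_gt (circularChromaticNumber G /
      (circularChromaticNumber G * b - 1) + 1 / b)
    have hfrac : 0 < circularChromaticNumber G / (circularChromaticNumber G * b - 1) :=
      div_pos hcpos (by linarith)
    have hinv : 0 < 1 / b := by positivity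
    have hn0 : (0 : ℝ) < n := by linarith
    have h1 : circularChromaticNumber G < n * (circularChromaticNumber G * b - 1) := by
      rw [← div_lt_iff₀ (by linarith)]
      linarith
    have h2 : 1 < n * b := by
      rw [← div_lt_iff₀ hb0]
      linarith
    have hd : 0 < ⌊n * b⌋₊ := Nat.floor_pos.2 h2.le
    have hd' : (⌊n * b⌋₊ : ℝ) ≤ n * b := Nat.floor_le (by positivity)
    have hd1 := Nat.lt_floor_add_one (n * b)
    have hmem : (n : ℝ) / ⌊n * b⌋₊ ∈ X := by
      refine ⟨n, ⌊n * b⌋₊, hd, ?_, HasCircularLabelling.nonempty_hom hd (by exact_mod_cast hn0)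
        (HasCircularLabelling.mono hε ?_), rfl⟩
      · have : (2 * ⌊n * b⌋₊ : ℝ) ≤ n := by nlinarith
        exact_mod_cast this
      · have : (⌊n * b⌋₊ : ℝ) / n ≤ b := by
          rw [div_le_iff₀ hn0]
          linarith
        linarith
    have h3 := csInf_le hbdd hmem
    rw [← hc, le_div_iff₀ (by exact_mod_cast hd)] at h3
    nlinarith
  · intro b hb
    have hbX : ∀ x ∈ X, b ≤ 1 / 2 - 1 / x := fun x hx => hb (hXlab x hx)
    obtain ⟨x₀, hx₀⟩ := hne
    have hpos : 0 < 1 / 2 - b := by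
      have h1 := hbX x₀ hx₀
      have h2 : 0 < 1 / x₀ := one_div_pos.2 (by linarith [hX2 x₀ hx₀])
      linarith
    have : 1 / (1 / 2 - b) ≤ circularChromaticNumber G := by
      refine le_csInf ⟨x₀, hx₀⟩ fun x hx => ?_
      have h1 := hbX x hx
      rw [one_div_le hpos (by linarith [hX2 x hx])]
      linarith
    rw [one_div_le hpos (by linarith)] at this
    linarith

lemma exists_odd_ratio_between {a b : ℝ} (ha : 0 ≤ a) (hab : a < b) :
    ∃ r s : ℕ, a < (2 * r + 1 : ℝ) / (2 * s + 1) ∧ (2 * r + 1 : ℝ) / (2 * s + 1) < b := by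
  obtain ⟨s, hs⟩ := exists_nat_gt (2 / (b - a))
  rw [div_lt_iff₀ (by linarith)] at hs
  have hs' : (0 : ℝ) < 2 * s + 1 := by positivity
  refine ⟨⌊((2 * s + 1) * a + 1) / 2⌋₊, s, ?_, ?_⟩
  · rw [lt_div_iff₀ hs']
    linarith [Nat.lt_floor_add_one (((2 * s + 1) * a + 1) / 2)]
  · rw [div_lt_iff₀ hs']
    have h1 := Nat.floor_le (show 0 ≤ ((2 * s + 1) * a + 1) / 2 by positivity)
    have h2 : (0 : ℝ) ≤ s * (b - a) := mul_nonneg (by positivity) (by linarith)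
    linarith

instance subdivVertex_finite [Finite V] (m : ℕ) : Finite (SubdivVertex G m) :=
  inferInstanceAs (Finite (V ⊕ (G.edgeSet × Fin (m - 1))))

/-- The odd girth condition comes for free from the labelling: error `m / (6 * k)` forces odd cycles
of length at least `3 * k / m`. -/
lemma chi_fracPower_le_three_iff [Finite V] {k m : ℕ} (hm : Odd m) (hk : Odd k) :
    (chi (fracPower G k m) ≤ 3 ∧ (k : ℕ∞) < m * oddGirth G) ↔
      HasCircularLabelling G (m / (6 * k)) := by
  have e : (m : ℝ) / (6 * k) = m * (1 / 6 / k) := by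
    rw [div_div, mul_one_div]
  rw [chi_le_iff, colorable_three_iff]
  constructor
  · rintro ⟨h, hog⟩
    rw [e]
    exact (hasCircularLabelling_fracPower_iff hm hk hog (by norm_num) (by norm_num)).1 h
  · intro h
    have hog := h.lt_mul_oddGirth hm.pos hk.pos
    rw [e] at h
    exact ⟨(hasCircularLabelling_fracPower_iff hm hk hog (by norm_num) (by norm_num)).2 h, hog⟩

lemma mu_eq_of_isGLB [Finite V] {c : ℝ} (hc : 0 < c)
    (h : IsGLB {ε | HasCircularLabelling G ε} c) : mu G = 1 / (6 * c) := by
  have hset : ∀ r s : ℕ,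
      ((chi (fracPower G (2 * r + 1) (2 * s + 1)) : ℤ) ≤ (chi G : ℤ) + (3 - (chi G : ℤ)) ∧
        ((2 * r + 1 : ℕ) : ℕ∞) < ((2 * s + 1 : ℕ) : ℕ∞) * oddGirth G) ↔
      HasCircularLabelling G (1 / (6 * ((2 * r + 1 : ℝ) / (2 * s + 1)))) := by
    intro r s
    have e : (1 / (6 * ((2 * r + 1 : ℝ) / (2 * s + 1)))) =
        ((2 * s + 1 : ℕ) : ℝ) / (6 * (2 * r + 1 : ℕ)) := by
      push_cast
      field_simp
    rw [e, ← chi_fracPower_le_three_iff ⟨s, rfl⟩ ⟨r, rfl⟩]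
    refine and_congr_left fun _ => ?_
    omega
  have hlub : IsLUB {x : ℝ | ∃ r s : ℕ,
      (chi (fracPower G (2 * r + 1) (2 * s + 1)) : ℤ) ≤ (chi G : ℤ) + (3 - (chi G : ℤ)) ∧
      ((2 * r + 1 : ℕ) : ℕ∞) < ((2 * s + 1 : ℕ) : ℕ∞) * oddGirth G ∧
      x = (2 * r + 1 : ℝ) / (2 * s + 1 : ℝ)} (1 / (6 * c)) := by
    constructor
    · rintro x ⟨r, s, h1, h2, rfl⟩
      have h3 := h.1 ((hset r s).1 ⟨h1, h2⟩)
      have hx : 0 < (2 * r + 1 : ℝ) / (2 * s + 1) := by positivity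
      rw [le_div_iff₀ (by positivity)] at h3 ⊢
      linarith
    · intro y hy
      by_contra! hlt
      obtain ⟨r, s, h1, h2⟩ := exists_odd_ratio_between (le_max_right y 0)
        (max_lt hlt (by positivity : 0 < 1 / (6 * c)))
      have hx : 0 < (2 * r + 1 : ℝ) / (2 * s + 1) := by positivity
      have h3 : c < 1 / (6 * ((2 * r + 1 : ℝ) / (2 * s + 1))) := by
        rw [lt_div_iff₀ (by positivity)] at h2 ⊢
        linarith
      obtain ⟨ε, hε, -, hlt'⟩ := h.exists_between h3
      obtain ⟨h4, h5⟩ := (hset r s).2 (HasCircularLabelling.mono hε hlt'.le)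
      exact ((le_max_left y 0).trans_lt h1).not_ge (hy ⟨r, s, h4, h5, rfl⟩)
  -- Over the empty set, 0 would be an upper bound below the positive least one.
  refine hlub.csSup_eq (Set.nonempty_iff_ne_empty.2 fun hempty => ?_)
  rw [hempty] at hlub
  exact absurd (hlub.2 (by simp : (0 : ℝ) ∈ upperBounds ∅)) (not_le.2 (by positivity))

/-- One odd closed walk of length ℓ bounds every error below by 1/(2ℓ), hence also their infimum. -/
lemma circularError_pos [Finite V] (hG : ¬ G.IsBipartite) :
    0 < 1 / 2 - 1 / circularChromaticNumber G := by
  obtain ⟨u, p, hp⟩ := exists_odd_closed hG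
  have hpos : (0 : ℝ) < p.length := by exact_mod_cast hp.pos
  refine lt_of_lt_of_le (b := 1 / 2 / (p.length : ℝ)) (by positivity)
    ((isGLB_circularLabelling hG).2.2 fun ε hε => ?_)
  rw [div_le_iff₀' hpos]
  exact HasCircularLabelling.half_le_of_odd_closed hε p hp

/-- Odd powers of odd subdivisions of non-bipartite graphs are non-bipartite. -/
lemma fracPower_not_isBipartite {k m : ℕ} (hm : Odd m) (hk : Odd k) (hG : ¬ G.IsBipartite) :
    ¬ (fracPower G k m).IsBipartite := by
  intro h
  apply hG
  obtain ⟨c⟩ := h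
  have hstep : ∀ x y, (subdivision G m).Adj x y → c x ≠ c y := by
    intro x y hxy
    obtain ⟨j, rfl⟩ := hk
    obtain ⟨q, hq⟩ := exists_walk_add_two (.cons hxy .nil) (by simp) j
    refine c.valid ⟨hxy.ne, q, ?_⟩
    rw [hq]
    simp
    ring
  let c' : (subdivision G m).Coloring (Fin 2) := Coloring.mk c fun {x y} h => hstep x y h
  refine ⟨Coloring.mk (fun v => c (Sum.inl v)) fun {u v} huv => ?_⟩
  obtain ⟨p, hp⟩ := exists_walk_subdivision hm.pos huv
  have hval : ∀ x y, c' x ≠ c' y → c x ≠ c y := fun _ _ h => h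
  apply hval
  intro heq
  have : ∀ (x y : SubdivVertex G m) (q : (subdivision G m).Walk x y),
      ((c x : ℕ) + q.length) % 2 = (c y : ℕ) := by
    intro x y q
    induction q with
    | nil => simp only [Walk.length_nil]; omega
    | @cons a b d h q ih =>
      have h1 : (c a : ℕ) ≠ (c b : ℕ) := fun h' => hstep _ _ h (Fin.ext h')
      rw [Walk.length_cons]
      omega
  have h2 := this _ _ p
  have h3 : (c (Sum.inl u) : ℕ) = (c (Sum.inl v) : ℕ) := congrArg Fin.val heq
  obtain ⟨j, hj⟩ := hm
  omega

lemma isGLB_fracPower {k m : ℕ} (hm : Odd m) (hk : Odd k)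
    (hog : (k : ℕ∞) < m * oddGirth G) {c : ℝ} (hc : c < 1 / 4) (hc0 : 0 < c)
    (h : IsGLB {ε | HasCircularLabelling (fracPower G k m) ε} c) :
    IsGLB {ε | HasCircularLabelling G ε} (m * (c / k)) := by
  have hm' : (0 : ℝ) < m := by exact_mod_cast hm.pos
  have hk' : (0 : ℝ) < k := by exact_mod_cast hk.pos
  constructor
  · intro ε hε
    by_contra! hlt
    have hδ : ε / m * k < c := by
      rw [← lt_div_iff₀ hk', div_lt_iff₀ hm']
      linarith
    have e : ε = m * (ε / m * k / k) := by field_simp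
    -- The equivalence for powers needs a nonnegative error, hence the truncation at 0.
    have hfp : HasCircularLabelling (fracPower G k m) (max (ε / m * k) 0) := by
      refine (hasCircularLabelling_fracPower_iff hm hk hog (le_max_right _ _)
        (by rw [max_lt_iff]; constructor <;> linarith)).2 (HasCircularLabelling.mono hε ?_)
      calc ε = m * (ε / m * k / k) := e
        _ ≤ m * (max (ε / m * k) 0 / k) := by gcongr; exact le_max_left _ _
    exact (max_lt hδ hc0).not_ge (h.1 hfp)
  · intro b hb
    have hle : b / m * k ≤ c := by
      by_contra! hlt
      obtain ⟨ε, hε, h1, h2⟩ := h.exists_between (lt_min hlt hc)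
      have h3 := hb ((hasCircularLabelling_fracPower_iff hm hk hog (hc0.le.trans h1)
        (h2.trans_le (min_le_right _ _))).1 hε)
      have h4 : b / m * k ≤ ε := by
        rw [← le_div_iff₀ hk', div_le_iff₀ hm']
        linarith
      exact (h2.trans_le (min_le_left _ _)).not_ge h4
    rw [← le_div_iff₀ hk', div_le_iff₀ hm'] at hle
    linarith

end CircularChromaticNumber

end GraphPower

theorem mainTheorem10 {V : Type*} [Finite V] (G : SimpleGraph V) (hG : ¬ G.IsBipartite)
    (r s : ℕ)
    (hog : ((2 * r + 1 : ℕ) : ℕ∞) < ((2 * s + 1 : ℕ) : ℕ∞) * GraphPower.oddGirth G)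
    (hχ : GraphPower.circularChromaticNumber
      (GraphPower.fracPower G (2 * r + 1) (2 * s + 1)) < 4) :
    GraphPower.mu (GraphPower.fracPower G (2 * r + 1) (2 * s + 1)) =
        (2 * s + 1 : ℝ) / (2 * r + 1 : ℝ) * GraphPower.mu G ∧
      (2 * s + 1 : ℝ) / (2 * r + 1 : ℝ) * GraphPower.mu G =
        (2 * s + 1 : ℝ) / (3 * (2 * r + 1 : ℝ)) *
          (GraphPower.circularChromaticNumber G /
            (GraphPower.circularChromaticNumber G - 2)) := by
  open GraphPower in
  have hm : Odd (2 * s + 1) := ⟨s, rfl⟩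
  have hk : Odd (2 * r + 1) := ⟨r, rfl⟩
  have hH := fracPower_not_isBipartite hm hk hG
  obtain ⟨hGpos, hGglb⟩ := isGLB_circularLabelling hG
  obtain ⟨hHpos, hHglb⟩ := isGLB_circularLabelling hH
  have hG0 := circularError_pos hG
  have hH0 := circularError_pos hH
  have hH4 : 1 / 2 - 1 / circularChromaticNumber (fracPower G (2 * r + 1) (2 * s + 1)) < 1 / 4 := by
    have := one_div_lt_one_div_of_lt hHpos hχ
    linarith
  -- Two expressions for the optimal error of `G`, one computed through the power and one from χ_c.
  have huniq := (isGLB_fracPower hm hk hog hH4 hH0 hHglb).unique hGglb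
  rw [mu_eq_of_isGLB hG0 hGglb, mu_eq_of_isGLB hH0 hHglb]
  constructor
  · rw [← huniq]
    push_cast
    field_simp
  · have hx2 : circularChromaticNumber G - 2 ≠ 0 := by
      intro h
      rw [sub_eq_zero.1 h] at hG0
      norm_num at hG0
    have e : 1 / 2 - 1 / circularChromaticNumber G =
        (circularChromaticNumber G - 2) / (2 * circularChromaticNumber G) := by
      field_simp
    rw [e]
    field_simp
    norm_num
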